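/- Let $r>1$ and let $D_r=\{(x,y)\in\mathbb{R}^2 : x^2+(y-(r+1)/2)^2<(r-1)^2/4\}$ be the open disc inside the detector ring $\partial D_r$, the source being at the origin $O$. For $p>0$ and $\phi\in\mathbb{R}$ let $D_{p,\phi}$ be the disc of diameter $p$ whose centre is $\left(\tfrac p2\cos\phi,\tfrac p2\sin\phi\right)$, so that its boundary passes through $O$, and for a smooth compactly supported $f:\mathbb{R}^2\to\mathbb{R}$ let $$\mathcal{D}_1f(p,\phi)=\iint_{D_{1/p,\phi}} f\,\mathrm{d}A .$$ Let $f\in C_0^\infty(D_r)$, that is, $f:\mathbb{R}^2\to\mathbb{R}$ is smooth with compact support contained in $D_r$. Then the values $\mathcal{D}_1f(p,\phi)$ for those $p>0$ and $\phi$ such that $$D_{1/p,\phi}\cap D_r\neq\emptyset\quad\text{and}\quad \partial D_{1/p,\phi}\cap\partial D_r\neq\emptyset$$ determine $f$ uniquely: if $f,g\in C_0^\infty(D_r)$ satisfy $\mathcal{D}_1f(p,\phi)=\mathcal{D}_1g(p,\phi)$ for all such $(p,\phi)$, then $f=g$. That is, the data from the discs through the single source position $O$ suffice. -/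

import Mathlib

open scoped Distributions

/-- The disc `D_{p,φ}` whose boundary passes through the origin and whose centre has polar
coordinates `(p / 2, φ)`; its diameter is `p`. -/
noncomputable def originDisc (p φ : ℝ) : Set (EuclideanSpace ℝ (Fin 2)) :=
  Metric.closedBall !₂[p / 2 * Real.cos φ, p / 2 * Real.sin φ] (p / 2)

/-- The disc transform `𝒟₁ f (p, φ)`, the integral of `f` over the disc `D_{1/p,φ}`
with respect to area (used for `p > 0`). -/
noncomputable def discTransform (f : EuclideanSpace ℝ (Fin 2) → ℝ) (p φ : ℝ) : ℝ :=
  ∫ x in originDisc (1 / p) φ, f x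

/-- The open disc `D_r` of points inside the detector ring, as an open subset of the plane. -/
noncomputable def detectorDisc (r : ℝ) : TopologicalSpace.Opens (EuclideanSpace ℝ (Fin 2)) :=
  ⟨{x | x 0 ^ 2 + (x 1 - (r + 1) / 2) ^ 2 < (r - 1) ^ 2 / 4},
    isOpen_lt (by fun_prop) (by fun_prop)⟩

/-- The region `R_{p,φ} = D_{1/p,φ} ∩ D_r`. -/
noncomputable def scatteringRegion (r p φ : ℝ) : Set (EuclideanSpace ℝ (Fin 2)) :=
  originDisc (1 / p) φ ∩ detectorDisc r

/-!
The inversion `x ↦ x / ‖x‖²` turns the discs through the origin into the closed half-planes that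
do not contain the origin, so the disc transform of `h = f - g` is the family of half-plane masses
of a signed measure, the image of `h` under the inversion. Half-plane masses determine a finite
measure: they determine its images under all linear functionals, hence its characteristic
function (`ext_of_halfSpace`, applied to the images of the positive and negative parts of `h`).
This gives `ae_eq_zero_of_setIntegral_originDisc`: an integrable function with vanishing total
integral and vanishing integral over every disc through the origin is zero. Working with image
measures avoids any Jacobian.

The admissible discs suffice because a disc through the origin whose boundary does not meet
`∂D_r` either misses `D_r` or contains it (`disjoint_or_subset_originDisc`): its boundary is a
connected set containing the origin, which lies outside `D_r`. In the first case the integral of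
`h` vanishes trivially; in the second it is the total integral, which is also the integral over
the admissible disc with centre `(0, r / 2)` and diameter `r`, which contains `D_r` and touches
`∂D_r` at `(0, r)`.
-/

open MeasureTheory Set
open scoped RealInnerProductSpace

/-! ### Measures determined by half-spaces -/

/-- Two finite measures on the line agree as soon as they have the same total mass and agree on
the closed half-lines that do not contain `0`. -/
theorem ext_of_Ici_of_Iic {μ ν : Measure ℝ} [IsFiniteMeasure μ] [IsFiniteMeasure ν]
    (huniv : μ univ = ν univ) (hpos : ∀ c : ℝ, 0 < c → μ (Ici c) = ν (Ici c))
    (hneg : ∀ c : ℝ, c < 0 → μ (Iic c) = ν (Iic c)) : μ = ν := by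
  refine Measure.ext_of_Iic μ ν fun c ↦ ?_
  rcases lt_or_ge c 0 with hc | hc
  · exact hneg c hc
  -- For `0 ≤ c` the complement `Ioi c` is an increasing union of half-lines `Ici a` with `0 < a`.
  have hIoi : μ (Ioi c) = ν (Ioi c) := by
    have hU : ⋃ n : ℕ, Ici (c + 1 / ((n : ℝ) + 1)) = Ioi c := by
      refine iUnion_Ici_eq_Ioi_of_lt_of_tendsto (F := Filter.atTop)
        (fun n ↦ lt_add_of_pos_right c Nat.one_div_pos_of_nat) ?_
      simpa using tendsto_one_div_add_atTop_nhds_zero_nat.const_add c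
    have hmono : Monotone fun n : ℕ ↦ Ici (c + 1 / ((n : ℝ) + 1)) := fun m n hmn ↦
      Ici_subset_Ici.2 (by gcongr)
    rw [← hU, hmono.measure_iUnion, hmono.measure_iUnion]
    exact iSup_congr fun n ↦ hpos _ (by positivity)
  rw [← compl_Ioi, measure_compl measurableSet_Ioi (measure_ne_top _ _),
    measure_compl measurableSet_Ioi (measure_ne_top _ _), huniv, hIoi]

/-- A form of the Cramér–Wold theorem: finite measures with the same total mass that agree on the
closed half-spaces not containing the origin are equal. -/
theorem ext_of_halfSpace {E : Type*} [NormedAddCommGroup E] [InnerProductSpace ℝ E]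
    [CompleteSpace E] [SecondCountableTopology E] [MeasurableSpace E] [BorelSpace E]
    {μ ν : Measure E} [IsFiniteMeasure μ] [IsFiniteMeasure ν] (huniv : μ univ = ν univ)
    (h : ∀ (t : E) (c : ℝ), 0 < c → μ {y | c ≤ ⟪y, t⟫} = ν {y | c ≤ ⟪y, t⟫}) : μ = ν := by
  refine Measure.ext_of_charFun (funext fun t ↦ ?_)
  have hm : Measurable fun y : E ↦ ⟪y, t⟫ := by fun_prop
  have hmap : μ.map (fun y ↦ ⟪y, t⟫) = ν.map (fun y ↦ ⟪y, t⟫) := by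
    refine ext_of_Ici_of_Iic ?_ (fun c hc ↦ ?_) fun c hc ↦ ?_
    · simpa [Measure.map_apply hm MeasurableSet.univ] using huniv
    · rw [Measure.map_apply hm measurableSet_Ici, Measure.map_apply hm measurableSet_Ici]
      exact h t c hc
    · rw [Measure.map_apply hm measurableSet_Iic, Measure.map_apply hm measurableSet_Iic]
      simpa [preimage, inner_neg_right] using h (-t) (-c) (neg_pos.2 hc)
  have hint : ∀ ρ : Measure E,
      charFun ρ t = ∫ s, Complex.exp (s * Complex.I) ∂ρ.map (fun y ↦ ⟪y, t⟫) := fun ρ ↦ by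
    rw [charFun_apply, integral_map hm.aemeasurable (by fun_prop)]
  rw [hint, hint, hmap]

theorem withDensity_ofReal_eq_iff_setIntegral_eq_zero {α : Type*} [MeasurableSpace α]
    {μ : Measure α} {h : α → ℝ} (hh : Integrable h μ) {s : Set α} (hs : MeasurableSet s) :
    μ.withDensity (fun x ↦ ENNReal.ofReal (h x)) s =
      μ.withDensity (fun x ↦ ENNReal.ofReal (-h x)) s ↔ ∫ x in s, h x ∂μ = 0 := by
  rw [withDensity_apply _ hs, withDensity_apply _ hs,
    integral_eq_lintegral_pos_part_sub_lintegral_neg_part hh.integrableOn, sub_eq_zero,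
    ENNReal.toReal_eq_toReal_iff' (Integrable.lintegral_lt_top hh.integrableOn).ne
      (Integrable.lintegral_lt_top (f := fun x ↦ -h x) hh.neg.integrableOn).ne]

/-! ### Discs through the origin and half-planes -/

theorem mem_originDisc {p φ : ℝ} (hp : 0 ≤ p) {x : EuclideanSpace ℝ (Fin 2)} :
    x ∈ originDisc p φ ↔ ‖x‖ ^ 2 ≤ p * ⟪x, !₂[Real.cos φ, Real.sin φ]⟫ := by
  rw [originDisc, Metric.mem_closedBall, EuclideanSpace.dist_eq, Real.sqrt_le_left (by positivity),
    EuclideanSpace.real_norm_sq_eq]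
  simp only [Fin.sum_univ_two, Real.dist_eq, sq_abs, PiLp.inner_apply, RCLike.inner_apply,
    conj_trivial, Matrix.cons_val_zero, Matrix.cons_val_one]
  have := Real.cos_sq_add_sin_sq φ
  constructor <;> intro h
  · linear_combination h - p ^ 2 / 4 * this
  · linear_combination h + p ^ 2 / 4 * this

theorem exists_eq_smul_cos_sin (t : EuclideanSpace ℝ (Fin 2)) :
    ∃ φ : ℝ, t = ‖t‖ • !₂[Real.cos φ, Real.sin φ] := by
  have hn : ‖t‖ = ‖(⟨t 0, t 1⟩ : ℂ)‖ := by
    rw [EuclideanSpace.norm_eq, Complex.norm_eq_sqrt_sq_add_sq]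
    simp [Fin.sum_univ_two]
  refine ⟨Complex.arg ⟨t 0, t 1⟩, ?_⟩
  ext i
  fin_cases i
  · simp [hn, Complex.norm_mul_cos_arg]
  · simp [hn, Complex.norm_mul_sin_arg]

/-- The inversion in the unit circle. In Mathlib's convention it fixes the origin. -/
noncomputable def unitInversion (x : EuclideanSpace ℝ (Fin 2)) : EuclideanSpace ℝ (Fin 2) :=
  EuclideanGeometry.inversion 0 1 x

theorem unitInversion_apply (x : EuclideanSpace ℝ (Fin 2)) :
    unitInversion x = (‖x‖ ^ 2)⁻¹ • x := by
  simp [unitInversion, EuclideanGeometry.inversion]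

theorem unitInversion_involutive : Function.Involutive unitInversion :=
  EuclideanGeometry.inversion_involutive 0 one_ne_zero

theorem measurable_unitInversion : Measurable unitInversion := by
  simp only [funext unitInversion_apply]
  fun_prop

/-- The inversion carries half-planes not containing the origin to discs through the origin; the
origin itself is the image of the point at infinity, hence removed. -/
theorem preimage_unitInversion_halfPlane {n c φ : ℝ} (hn : 0 ≤ n) (hc : 0 < c) :
    unitInversion ⁻¹' {y | c ≤ ⟪y, n • !₂[Real.cos φ, Real.sin φ]⟫} =
      originDisc (n / c) φ \ {0} := by
  ext x
  rw [mem_sdiff, mem_singleton_iff, mem_originDisc (by positivity), mem_preimage, mem_ofPred_eq,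
    unitInversion_apply, real_inner_smul_left, real_inner_smul_right]
  rcases eq_or_ne x 0 with rfl | hx
  · simp [hc]
  · have : 0 < ‖x‖ ^ 2 := by positivity
    rw [inv_mul_eq_div, le_div_iff₀ this, div_mul_eq_mul_div, le_div_iff₀ hc, mul_comm c]
    simp [hx]

/-- The transform over discs through the origin is injective on integrable functions. -/
theorem ae_eq_zero_of_setIntegral_originDisc {h : EuclideanSpace ℝ (Fin 2) → ℝ}
    (hh : Integrable h) (htot : ∫ x, h x = 0)
    (hdisc : ∀ p φ : ℝ, 0 < p → ∫ x in originDisc p φ, h x = 0) : h =ᵐ[volume] 0 := by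
  have hfin₁ : IsFiniteMeasure (volume.withDensity fun x ↦ ENNReal.ofReal (h x)) :=
    isFiniteMeasure_withDensity_ofReal hh.2
  have hfin₂ : IsFiniteMeasure (volume.withDensity fun x ↦ ENNReal.ofReal (-h x)) :=
    isFiniteMeasure_withDensity_ofReal hh.neg.2
  have hmap : (volume.withDensity fun x ↦ ENNReal.ofReal (h x)).map unitInversion =
      (volume.withDensity fun x ↦ ENNReal.ofReal (-h x)).map unitInversion := by
    refine ext_of_halfSpace ?_ fun t c hc ↦ ?_
    · rw [Measure.map_apply measurable_unitInversion .univ,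
        Measure.map_apply measurable_unitInversion .univ, preimage_univ,
        withDensity_ofReal_eq_iff_setIntegral_eq_zero hh .univ, setIntegral_univ, htot]
    · have hs : MeasurableSet {y : EuclideanSpace ℝ (Fin 2) | c ≤ ⟪y, t⟫} :=
        measurableSet_le (by fun_prop) (by fun_prop)
      rw [Measure.map_apply measurable_unitInversion hs,
        Measure.map_apply measurable_unitInversion hs,
        withDensity_ofReal_eq_iff_setIntegral_eq_zero hh (measurable_unitInversion hs)]
      rcases eq_or_ne t 0 with rfl | ht
      · simp [hc.not_ge]
      obtain ⟨φ, hφ⟩ := exists_eq_smul_cos_sin t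
      rw [hφ, preimage_unitInversion_halfPlane (norm_nonneg t) hc,
        setIntegral_congr_set (sdiff_null_ae_eq_self (measure_singleton 0))]
      exact hdisc _ _ (div_pos (norm_pos_iff.2 ht) hc)
  -- The inversion is its own inverse, so it can be cancelled from both image measures.
  have hid : unitInversion ∘ unitInversion = id := unitInversion_involutive.comp_self
  have heq := congrArg (fun ρ ↦ Measure.map unitInversion ρ) hmap
  simp only [Measure.map_map measurable_unitInversion measurable_unitInversion, hid,
    Measure.map_id] at heq
  refine hh.ae_eq_zero_of_forall_setIntegral_eq_zero fun s hs _ ↦ ?_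
  rw [← withDensity_ofReal_eq_iff_setIntegral_eq_zero hh hs, heq]

/-! ### Discs through the origin and the detector ring -/

theorem detectorDisc_eq_ball {r : ℝ} (hr : 1 < r) :
    (detectorDisc r : Set (EuclideanSpace ℝ (Fin 2))) =
      Metric.ball !₂[0, (r + 1) / 2] ((r - 1) / 2) := by
  ext x
  rw [Metric.mem_ball, EuclideanSpace.dist_eq, Real.sqrt_lt' (by linarith)]
  change x 0 ^ 2 + (x 1 - (r + 1) / 2) ^ 2 < (r - 1) ^ 2 / 4 ↔ _
  simp only [Fin.sum_univ_two, Real.dist_eq, sq_abs, Matrix.cons_val_zero, Matrix.cons_val_one]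
  rw [sub_zero, div_pow]
  norm_num

theorem inter_frontier_nonempty {X : Type*} [TopologicalSpace X] {s t : Set X}
    (ht : IsPreconnected t) (hs : (t ∩ s).Nonempty) (hs' : (t \ s).Nonempty) :
    (t ∩ frontier s).Nonempty := by
  by_contra! hempty
  have hfr : ∀ x ∈ t, x ∉ frontier s := fun x hx hx' ↦
    (hempty.subset ⟨hx, hx'⟩ : x ∈ (∅ : Set X))
  obtain ⟨x, hx, hxs⟩ := hs
  obtain ⟨y, hy, hys⟩ := hs'
  obtain ⟨z, -, hz, hz'⟩ := ht (interior s) (closure s)ᶜ isOpen_interior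
    isClosed_closure.isOpen_compl
    (fun z hz ↦ or_iff_not_imp_left.2 fun hi hc ↦ hfr z hz ⟨hc, hi⟩)
    ⟨x, hx, by_contra fun hi ↦ hfr x hx ⟨subset_closure hxs, hi⟩⟩
    ⟨y, hy, fun hc ↦ hfr y hy ⟨hc, fun hi ↦ hys (interior_subset hi)⟩⟩
  exact hz' (subset_closure (interior_subset hz))

/-- A disc whose boundary does not meet the detector ring either misses `D_r` or contains it. It
cannot lie inside `D_r`, because its boundary passes through the origin. -/
theorem disjoint_or_subset_originDisc {r p φ : ℝ} (hr : 1 < r) (hp : 0 < p)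
    (hf : ¬(frontier (originDisc p φ) ∩
      frontier (detectorDisc r : Set (EuclideanSpace ℝ (Fin 2)))).Nonempty) :
    Disjoint (originDisc p φ) (detectorDisc r) ∨
      (detectorDisc r : Set (EuclideanSpace ℝ (Fin 2))) ⊆ originDisc p φ := by
  have hsph : frontier (originDisc p φ) =
      Metric.sphere !₂[p / 2 * Real.cos φ, p / 2 * Real.sin φ] (p / 2) :=
    frontier_closedBall _ (by positivity)
  have hzero : (0 : EuclideanSpace ℝ (Fin 2)) ∈ frontier (originDisc p φ) := by
    rw [hsph, mem_sphere_iff_norm, EuclideanSpace.norm_eq,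
      Real.sqrt_eq_iff_eq_sq (by positivity) (by positivity)]
    simp only [Fin.sum_univ_two, Real.norm_eq_abs, sq_abs, PiLp.sub_apply, PiLp.zero_apply,
      Matrix.cons_val_zero, Matrix.cons_val_one]
    linear_combination p ^ 2 / 4 * Real.cos_sq_add_sin_sq φ
  have hzero' : (0 : EuclideanSpace ℝ (Fin 2)) ∉ detectorDisc r := by
    change ¬((0 : ℝ) ^ 2 + (0 - (r + 1) / 2) ^ 2 < (r - 1) ^ 2 / 4)
    nlinarith
  have hconn : IsPreconnected (frontier (originDisc p φ)) := by
    rw [hsph]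
    refine isPreconnected_sphere ?_ _ _
    rw [← Module.finrank_eq_rank, finrank_euclideanSpace_fin]
    norm_num
  have hempty : ¬((detectorDisc r : Set (EuclideanSpace ℝ (Fin 2))) ∩
      frontier (originDisc p φ)).Nonempty := fun hne ↦
    hf (inter_frontier_nonempty hconn (inter_comm _ _ ▸ hne) ⟨0, hzero, hzero'⟩)
  have hconn' : IsPreconnected (detectorDisc r : Set (EuclideanSpace ℝ (Fin 2))) := by
    rw [detectorDisc_eq_ball hr]
    exact (convex_ball _ _).isPreconnected
  by_contra! hcon
  rw [not_disjoint_iff_nonempty_inter, inter_comm, ← sdiff_nonempty] at hcon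
  exact hempty (inter_frontier_nonempty hconn' hcon.1 hcon.2)

/-- The disc with diameter from the origin to `(0, r)` contains `D_r` and touches the detector
ring at `(0, r)`. -/
theorem detectorDisc_subset_tangentDisc {r : ℝ} (hr : 1 < r) :
    (detectorDisc r : Set (EuclideanSpace ℝ (Fin 2))) ⊆ originDisc r (Real.pi / 2) := by
  rw [detectorDisc_eq_ball hr, originDisc]
  refine Metric.ball_subset_closedBall.trans (Metric.closedBall_subset_closedBall' ?_)
  rw [EuclideanSpace.dist_eq]
  simp only [Fin.sum_univ_two, Real.dist_eq, sq_abs, Matrix.cons_val_zero, Matrix.cons_val_one,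
    Real.cos_pi_div_two, Real.sin_pi_div_two]
  rw [show (0 - r / 2 * 0) ^ 2 + ((r + 1) / 2 - r / 2 * 1) ^ 2 = (1 / 2 : ℝ) ^ 2 by ring,
    Real.sqrt_sq (by norm_num)]
  linarith

theorem tangentDisc_frontier_inter_nonempty {r : ℝ} (hr : 1 < r) :
    (frontier (originDisc r (Real.pi / 2)) ∩
      frontier (detectorDisc r : Set (EuclideanSpace ℝ (Fin 2)))).Nonempty := by
  refine ⟨!₂[0, r], ?_, ?_⟩
  · rw [originDisc, frontier_closedBall _ (by linarith), mem_sphere_iff_norm,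
      EuclideanSpace.norm_eq, Real.sqrt_eq_iff_eq_sq (by positivity) (by linarith)]
    simp [Fin.sum_univ_two]
    ring
  · rw [detectorDisc_eq_ball hr, frontier_ball _ (by linarith), mem_sphere_iff_norm,
      EuclideanSpace.norm_eq, Real.sqrt_eq_iff_eq_sq (by positivity) (by linarith)]
    simp [Fin.sum_univ_two]
    ring

/-- Vanishing over the discs that meet `D_r` and whose boundary meets the detector ring implies
vanishing of the total integral and over all discs through the origin. -/
theorem setIntegral_originDisc_eq_zero {r : ℝ} (hr : 1 < r) {h : EuclideanSpace ℝ (Fin 2) → ℝ}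
    (hsupp : Function.support h ⊆ detectorDisc r)
    (hdata : ∀ p φ : ℝ, 0 < p → (originDisc p φ ∩ detectorDisc r).Nonempty →
      (frontier (originDisc p φ) ∩
        frontier (detectorDisc r : Set (EuclideanSpace ℝ (Fin 2)))).Nonempty →
      ∫ x in originDisc p φ, h x = 0) :
    ∫ x, h x = 0 ∧ ∀ p φ : ℝ, 0 < p → ∫ x in originDisc p φ, h x = 0 := by
  have hcover : ∀ s, (detectorDisc r : Set (EuclideanSpace ℝ (Fin 2))) ⊆ s →
      ∫ x in s, h x = ∫ x, h x := fun s hs ↦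
    setIntegral_eq_integral_of_forall_compl_eq_zero fun x hx ↦
      Function.notMem_support.1 fun hx' ↦ hx (hs (hsupp hx'))
  have htot : ∫ x, h x = 0 := by
    rw [← hcover _ (detectorDisc_subset_tangentDisc hr)]
    refine hdata _ _ (by linarith) ?_ (tangentDisc_frontier_inter_nonempty hr)
    rw [inter_eq_right.2 (detectorDisc_subset_tangentDisc hr), detectorDisc_eq_ball hr]
    exact Metric.nonempty_ball.2 (by linarith)
  refine ⟨htot, fun p φ hp ↦ ?_⟩
  by_cases hf : (frontier (originDisc p φ) ∩
      frontier (detectorDisc r : Set (EuclideanSpace ℝ (Fin 2)))).Nonempty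
  · by_cases hne : (originDisc p φ ∩ detectorDisc r).Nonempty
    · exact hdata p φ hp hne hf
    · exact setIntegral_eq_zero_of_forall_eq_zero fun x hx ↦
        Function.notMem_support.1 fun hx' ↦ hne ⟨x, hx, hsupp hx'⟩
  · rcases disjoint_or_subset_originDisc hr hp hf with hd | hs
    · exact setIntegral_eq_zero_of_forall_eq_zero fun x hx ↦
        Function.notMem_support.1 fun hx' ↦ hd.notMem_of_mem_left hx (hsupp hx')
    · rw [hcover _ hs, htot]

theorem corollary2 (r : ℝ) (hr : 1 < r) (f g : 𝓓(detectorDisc r, ℝ))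
    (hfg : ∀ p φ : ℝ, 0 < p →
      (scatteringRegion r p φ).Nonempty →
      (frontier (originDisc (1 / p) φ) ∩
        frontier (detectorDisc r : Set (EuclideanSpace ℝ (Fin 2)))).Nonempty →
      discTransform f p φ = discTransform g p φ) :
    f = g := by
  have hfi : Integrable f := f.continuous.integrable_of_hasCompactSupport f.hasCompactSupport
  have hgi : Integrable g := g.continuous.integrable_of_hasCompactSupport g.hasCompactSupport
  have hsupp : Function.support (fun x ↦ f x - g x) ⊆ detectorDisc r :=
    (Function.support_sub _ _).trans <| union_subset
      ((subset_tsupport _).trans f.tsupport_subset) ((subset_tsupport _).trans g.tsupport_subset)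
  obtain ⟨htot, hdisc⟩ := setIntegral_originDisc_eq_zero hr hsupp fun p φ hp hne hf ↦ by
    have h := hfg (1 / p) φ (one_div_pos.2 hp)
    rw [scatteringRegion, discTransform, discTransform, one_div_one_div] at h
    rw [integral_sub hfi.integrableOn hgi.integrableOn, h hne hf, sub_self]
  have hzero := ae_eq_zero_of_setIntegral_originDisc (hfi.sub hgi) htot hdisc
  have heq := (Continuous.ae_eq_iff_eq volume (f.continuous.sub g.continuous)
    continuous_zero).1 hzero
  ext x
  exact sub_eq_zero.1 (congrFun heq x)
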